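/- Let $n\ge 2$. For a strictly decreasing sequence $1=\alpha_0>\alpha_1>\alpha_2>\dots>0$ with $\alpha_k\le C\alpha_{k+1}$ for some constant $C$ and all $k$, put $r_k=2^{-k}\alpha_k$, let $\mathbb V=\{-1,1\}^n$ be the set of vertices of $[-1,1]^n$, write $Q(a,r)=\prod_{i=1}^n(a_i-r,a_i+r)$, and let $$C_A=\bigcap_{k\ge1}\ \bigcup_{(v_1,\dots,v_k)\in\mathbb V^k}Q\Bigl(\tfrac12\sum_{j=1}^k r_{j-1}v_j,\ r_k\Bigr)\subset(-1,1)^n$$ be the associated Cantor set. There are such a sequence $(\alpha_k)$ and a Lipschitz mapping $f_L\colon[-1,1]^n\to[-1,1]^n$ with the following properties. 1. $C_A$ has Hausdorff dimension $n$ and Lebesgue measure zero. 2. $J_{f_L}=\det Df_L>0$ a.e. in $[-1,1]^n$. 3. There are homeomorphisms $f_k$ of $[-1,1]^n$ onto itself with $f_k(x)=x$ for all $x\in\partial[-1,1]^n$ such that $f_k\in W^{1,n-1}((-1,1)^n,\mathbb R^n)$ and $f_k\to f_L$ strongly in $W^{1,n-1}((-1,1)^n,\mathbb R^n)$. 4.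 $f_L(C_A)$ is a single point. Consequently every set $N\subset\mathbb R^n$ such that $f_L$ is one-to-one on $(-1,1)^n\setminus N$ has Hausdorff dimension $n$. -/

import Mathlib

open MeasureTheory Set Filter Topology
open scoped ENNReal NNReal ContDiff

namespace CantorSqueeze

/-- Euclidean space `ℝⁿ`. -/
abbrev E (n : ℕ) : Type := EuclideanSpace ℝ (Fin n)

/-- The closed cube `[-1,1]ⁿ`. -/
def closedCube (n : ℕ) : Set (E n) := {x | ∀ i, x i ∈ Icc (-1 : ℝ) 1}

/-- The open cube `Q(a,r)` with center `a` and edge length `2r`. -/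
def openCube {n : ℕ} (a : E n) (r : ℝ) : Set (E n) :=
  {x | ∀ i, x i ∈ Ioo (a i - r) (a i + r)}

/-! ### Cantor sets -/

/-- The set of the `2ⁿ` vertices of the cube `[-1,1]ⁿ`. -/
def vertices (n : ℕ) : Set (E n) := {v | ∀ i, v i = 1 ∨ v i = -1}

/-- Sequences `1 = α₀ > α₁ > ⋯ > 0` with `αₖ ≈ αₖ₊₁`, i.e. such that the ratios of consecutive
terms are bounded from above and from below. -/
structure IsCantorSequence (α : ℕ → ℝ) : Prop where
  zero : α 0 = 1
  strictAnti : StrictAnti α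
  pos : ∀ k, 0 < α k
  comparable : ∃ c : ℝ, 0 < c ∧ ∀ k, c * α k ≤ α (k + 1)

/-- The half edge `rₖ = 2⁻ᵏ αₖ` of the cubes of generation `k`. -/
noncomputable def radius (α : ℕ → ℝ) (k : ℕ) : ℝ := (2 ^ k)⁻¹ * α k

/-- The center `z_v = ½ ∑_{j=1}^{k} r_{j-1} v_j` of the cube of generation `k` with index
`v = (v₁,…,vₖ)` (here the entry `v_{j+1}` is `v j`, with `j : Fin k`). -/
noncomputable def center {n : ℕ} (α : ℕ → ℝ) {k : ℕ} (v : Fin k → E n) : E n :=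
  (1 / 2 : ℝ) • ∑ j : Fin k, radius α j • v j

/-- The Cantor set `⋂_{k ≥ 1} ⋃_{v ∈ Vᵏ} Q(z_v, rₖ)`. -/
def cantorSet (n : ℕ) (α : ℕ → ℝ) : Set (E n) :=
  ⋂ (k : ℕ) (_ : 1 ≤ k), ⋃ (v : Fin k → E n) (_ : ∀ j, v j ∈ vertices n),
    openCube (center α v) (radius α k)

/-! ### Sobolev mappings -/

/-- `G` is the weak derivative of `f : ℝⁿ → ℝⁿ` in the open set `U`: both are locally integrable
in `U` and `∫_U (∂_w φ) f = - ∫_U φ (G w)` for all `φ ∈ C_c^∞(U)` and all directions `w`. -/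
structure HasWeakDeriv {n : ℕ} (U : Set (E n)) (f : E n → E n) (G : E n → E n →L[ℝ] E n) :
    Prop where
  locallyIntegrable : LocallyIntegrableOn f U volume
  locallyIntegrable_deriv : LocallyIntegrableOn G U volume
  integral_eq : ∀ φ : E n → ℝ, ContDiff ℝ ∞ φ → HasCompactSupport φ → tsupport φ ⊆ U →
    ∀ w : E n, ∫ x in U, (fderiv ℝ φ x w) • f x = - ∫ x in U, φ x • G x w

/-- `f ∈ W^{1,p}(U, ℝⁿ)`. -/
def MemSobolev {n : ℕ} (U : Set (E n)) (p : ℝ≥0∞) (f : E n → E n) : Prop :=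
  MemLp f p (volume.restrict U) ∧
    ∃ G : E n → E n →L[ℝ] E n, HasWeakDeriv U f G ∧ MemLp G p (volume.restrict U)

/-- Strong convergence `fₖ → f` in `W^{1,p}(U, ℝⁿ)`: all the mappings belong to this space, and
`fₖ → f` and `Dfₖ → Df` in `L^p(U)`, where `D` is the weak derivative. -/
def TendstoSobolev {n : ℕ} (U : Set (E n)) (p : ℝ≥0∞) (f : ℕ → E n → E n) (f₀ : E n → E n) :
    Prop :=
  (∀ k, MemSobolev U p (f k)) ∧ MemSobolev U p f₀ ∧
    Tendsto (fun k => eLpNorm (f k - f₀) p (volume.restrict U)) atTop (𝓝 0) ∧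
    ∃ (G : ℕ → E n → E n →L[ℝ] E n) (G₀ : E n → E n →L[ℝ] E n),
      (∀ k, HasWeakDeriv U (f k) (G k)) ∧ HasWeakDeriv U f₀ G₀ ∧
      Tendsto (fun k => eLpNorm (G k - G₀) p (volume.restrict U)) atTop (𝓝 0)

/-- `f` restricts to a homeomorphism of `[-1,1]ⁿ` onto itself. -/
def IsCubeHomeomorphism {n : ℕ} (f : E n → E n) : Prop :=
  ∃ h : closedCube n ≃ₜ closedCube n, ∀ x : closedCube n, (h x : E n) = f x

end CantorSqueeze

/-!
The map `fL` is a smooth map that squeezes a null set containing the Cantor set to a point, and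
the approximating homeomorphisms are its convex combinations, factor by factor, with the identity.

The Cantor set of `αₖ = 1 / (k + 1)` is the `n`-th power of a closed null set
`K = cantorLine α ⊆ [-3/4, 3/4]`; put `Z = K ∪ {0}`. Choose a monotone `C¹` function `push` that
vanishes on `[-3/4, 3/4]` and fixes `±1`, and a `C¹` function `cut` with values in `[0, 1]` that
vanishes at `±1` and equals one exactly on `Z` (`nonempty_squeezeProfile`). The map `squeeze s i`
changes only the `i`-th coordinate `t` of `x`: with `c = s * ∏_{j ≠ i} cut (x j)`, it sends `t` to
`(1 - c) t + c * push t`, which is monotone in `t`, and strictly so if `c < 1`. Hence for `s < 1`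
it is a homeomorphism of the cube; it fixes the boundary because there either `c = 0` or
`push t = t`. For `s = 1` its Jacobian is at least `1 - ∏_{j ≠ i} cut (x j)`, which is positive
unless all the other coordinates lie in the null set `Z`; and if they do and `t ∈ Z`, then `t` is
sent to zero.

Composing over all `i` gives `squeezeList s`. At `s = 1`, the coordinates of a point of `Zⁿ` are
sent to zero one after the other, so the Cantor set goes to the origin (`squeezeList_one_eq_zero`);
the Jacobian of the composition is positive almost everywhere because the factors pull null sets
back to null sets (`ae_det_fderiv_squeezeList_pos`). All maps are `C¹` jointly in `s` and `x`, so as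
`s → 1` the maps and their derivatives converge uniformly on the cube, and thus in every `W^{1,p}`
(`tendstoSobolev_of_contDiff`).

For the dimension, send a point of `K` to the number in `[0, 1]` with the same binary code. Codes
that first differ at the place `m` belong to numbers at distance at most `2⁻ᵐ` and to points at
distance at least `2⁻ᵐ (αₘ - αₘ₊₁)`. As `αₘ - αₘ₊₁` decays polynomially only, this map is Hölder
continuous with every exponent `r < 1`; applied in each coordinate it covers the open unit cube, so
`n ≤ dimH (cantorSet n α) / r` (`natCast_le_dimH_cantorSet_div`). Finally, a set off which `fL` is
injective contains all points but one of the Cantor set (`dimH_eq_of_injOn_diff`).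
-/

namespace CantorSqueeze

/-! ### The Cantor set of the sequence `1 / (k + 1)` -/

/-- The sequence `αₖ = 1 / (k + 1)`. It tends to zero, so the Cantor set is null, but it does so
slowly enough, and with large enough differences, for the dimension to be full. -/
noncomputable def harmonicSeq (k : ℕ) : ℝ := 1 / (k + 1)

lemma isCantorSequence_harmonicSeq : IsCantorSequence harmonicSeq where
  zero := by simp [harmonicSeq]
  strictAnti := by
    refine strictAnti_nat_of_succ_lt fun k => ?_
    unfold harmonicSeq
    apply one_div_lt_one_div_of_lt <;> push_cast <;> linarith [(Nat.cast_nonneg k : (0 : ℝ) ≤ k)]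
  pos k := by unfold harmonicSeq; positivity
  comparable := by
    refine ⟨1 / 2, by norm_num, fun k => ?_⟩
    unfold harmonicSeq
    have hk : (0 : ℝ) ≤ k := Nat.cast_nonneg k
    rw [div_mul_div_comm, one_mul]
    apply one_div_le_one_div_of_le <;> push_cast <;> linarith

lemma tendsto_harmonicSeq : Tendsto harmonicSeq atTop (𝓝 0) :=
  tendsto_one_div_add_atTop_nhds_zero_nat

lemma harmonicSeq_sub_succ_ge (m : ℕ) :
    1 / ((m : ℝ) + 2) ^ 2 ≤ harmonicSeq m - harmonicSeq (m + 1) := by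
  have hm : (0 : ℝ) ≤ m := Nat.cast_nonneg m
  have h : harmonicSeq m - harmonicSeq (m + 1) = 1 / (((m : ℝ) + 1) * (m + 2)) := by
    unfold harmonicSeq
    push_cast
    field_simp
    ring
  rw [h]
  apply one_div_le_one_div_of_le <;> nlinarith

/-- The sign `±1` encoded by a binary digit. -/
def digitSign (d : Fin 2) : ℝ := 2 * (d : ℕ) - 1

lemma digitSign_eq (d : Fin 2) : digitSign d = 1 ∨ digitSign d = -1 := by
  fin_cases d <;> norm_num [digitSign]

lemma abs_digitSign (d : Fin 2) : |digitSign d| = 1 := by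
  rcases digitSign_eq d with h | h <;> simp [h]

lemma exists_digitSign {t : ℝ} (ht : t = 1 ∨ t = -1) : ∃ d, digitSign d = t := by
  rcases ht with rfl | rfl
  · exact ⟨1, by norm_num [digitSign]⟩
  · exact ⟨0, by norm_num [digitSign]⟩

/-- The one-dimensional Cantor set of which `cantorSet n α` is the `n`-th power, with closed
instead of open intervals, which makes it evidently closed. -/
def cantorLine (α : ℕ → ℝ) : Set ℝ :=
  ⋂ k : ℕ, ⋃ s : Fin (k + 1) → Fin 2,
    Metric.closedBall ((1 / 2) * ∑ j : Fin (k + 1), radius α j * digitSign (s j)) (radius α (k + 1))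

lemma isClosed_cantorLine (α : ℕ → ℝ) : IsClosed (cantorLine α) :=
  isClosed_iInter fun _ => isClosed_iUnion_of_finite fun _ => Metric.isClosed_closedBall

lemma volume_cantorLine {α : ℕ → ℝ} (hα : Tendsto α atTop (𝓝 0)) :
    volume (cantorLine α) = 0 := by
  have hle : ∀ k : ℕ, volume (cantorLine α) ≤ ENNReal.ofReal (2 * α (k + 1)) := by
    intro k
    calc volume (cantorLine α)
        ≤ volume (⋃ s : Fin (k + 1) → Fin 2, Metric.closedBall
            ((1 / 2) * ∑ j : Fin (k + 1), radius α j * digitSign (s j)) (radius α (k + 1))) :=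
          measure_mono (iInter_subset _ k)
      _ ≤ ∑ s : Fin (k + 1) → Fin 2, volume (Metric.closedBall
            ((1 / 2) * ∑ j : Fin (k + 1), radius α j * digitSign (s j)) (radius α (k + 1))) :=
          measure_iUnion_fintype_le _ _
      _ = ENNReal.ofReal (2 * α (k + 1)) := by
          simp only [Real.volume_closedBall, Finset.sum_const, Finset.card_univ, Fintype.card_fun,
            Fintype.card_fin, nsmul_eq_mul]
          rw [← ENNReal.ofReal_natCast, ← ENNReal.ofReal_mul (by positivity)]
          congr 1
          unfold radius
          push_cast
          field_simp
  have hlim : Tendsto (fun k : ℕ => ENNReal.ofReal (2 * α (k + 1))) atTop (𝓝 0) := by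
    have := ENNReal.tendsto_ofReal ((hα.comp (tendsto_add_atTop_nat 1)).const_mul 2)
    simpa using this
  exact le_antisymm (ge_of_tendsto' hlim hle) zero_le

/-- The two intervals of the first generation have centers `±1/2` and half length `1/4`. -/
lemma abs_le_of_mem_cantorLine {t : ℝ} (ht : t ∈ cantorLine harmonicSeq) : |t| ≤ 3 / 4 := by
  obtain ⟨s, hs⟩ := mem_iUnion.1 (mem_iInter.1 ht 0)
  rw [Metric.mem_closedBall, Real.dist_eq] at hs
  have h1 := abs_digitSign (s 0)
  simp only [radius, harmonicSeq, Nat.reduceAdd, Fin.sum_univ_one, Fin.val_zero] at hs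
  norm_num at hs
  have h2 := abs_sub_abs_le_abs_sub t (1 / 2 * digitSign (s 0))
  rw [abs_mul, h1] at h2
  norm_num at h2
  linarith

lemma apply_mem_cantorLine {n : ℕ} {α : ℕ → ℝ} {x : E n} (hx : x ∈ cantorSet n α) (i : Fin n) :
    x i ∈ cantorLine α := by
  refine mem_iInter.2 fun k => ?_
  obtain ⟨v, hv, hxv⟩ := mem_iUnion₂.1 (mem_iInter₂.1 hx (k + 1) (Nat.le_add_left 1 k))
  choose s hs using fun j => exists_digitSign (hv j i)
  refine mem_iUnion.2 ⟨s, ?_⟩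
  have hc : center α v i = 1 / 2 * ∑ j : Fin (k + 1), radius α j * digitSign (s j) := by
    simp [center, hs]
  have := hxv i
  rw [hc] at this
  rw [Metric.mem_closedBall, Real.dist_eq, abs_le]
  constructor <;> linarith [this.1, this.2]

lemma volume_setOf_apply_mem {n : ℕ} (i : Fin n) {K : Set ℝ} (hK : volume K = 0) :
    volume {x : E n | x i ∈ K} = 0 := by
  have h := (PiLp.volume_preserving_ofLp (Fin n)).quasiMeasurePreserving.preimage_null
    ((Measure.quasiMeasurePreserving_eval (fun _ : Fin n => (volume : Measure ℝ)) i).preimage_null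
      hK)
  exact h

lemma volume_cantorSet {n : ℕ} (hn : 0 < n) {α : ℕ → ℝ} (hα : Tendsto α atTop (𝓝 0)) :
    volume (cantorSet n α) = 0 :=
  measure_mono_null (fun _ hx => apply_mem_cantorLine hx (⟨0, hn⟩ : Fin n))
    (volume_setOf_apply_mem _ (volume_cantorLine hα))

/-! ### Coding the Cantor set by binary sequences -/

section Coding

variable {α : ℕ → ℝ}

lemma radius_pos (hα : IsCantorSequence α) (k : ℕ) : 0 < radius α k :=
  mul_pos (by positivity) (hα.pos k)

lemma radius_add_le (hα : IsCantorSequence α) (k j : ℕ) :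
    radius α (j + k) ≤ radius α k * (1 / 2) ^ j := by
  have h : α (j + k) ≤ α k := hα.strictAnti.antitone (Nat.le_add_left k j)
  unfold radius
  rw [pow_add, mul_inv, one_div, inv_pow]
  calc ((2 : ℝ) ^ j)⁻¹ * (2 ^ k)⁻¹ * α (j + k) ≤ ((2 : ℝ) ^ j)⁻¹ * (2 ^ k)⁻¹ * α k := by gcongr
    _ = _ := by ring

lemma summable_radius (hα : IsCantorSequence α) (k : ℕ) :
    Summable fun j => radius α (j + k) :=
  Summable.of_nonneg_of_le (fun _ => (radius_pos hα _).le) (radius_add_le hα k)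
    (summable_geometric_two.mul_left _)

lemma tsum_radius_lt (hα : IsCantorSequence α) (k : ℕ) :
    ∑' j, radius α (j + k) < 2 * radius α k := by
  have h : ∑' j : ℕ, radius α k * (1 / 2) ^ j = 2 * radius α k := by
    rw [tsum_mul_left, tsum_geometric_two, mul_comm]
  rw [← h]
  refine Summable.tsum_lt_tsum (i := 1) (radius_add_le hα k) ?_ (summable_radius hα k)
    (summable_geometric_two.mul_left _)
  have h1 : α (1 + k) < α k := hα.strictAnti (by omega)
  unfold radius
  rw [pow_add, mul_inv]
  calc ((2 : ℝ) ^ 1)⁻¹ * (2 ^ k)⁻¹ * α (1 + k) < ((2 : ℝ) ^ 1)⁻¹ * (2 ^ k)⁻¹ * α k := by gcongr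
    _ = _ := by ring

/-- The point of the one-dimensional Cantor set with the given binary code. -/
noncomputable def codedPoint (α : ℕ → ℝ) (a : ℕ → Fin 2) : ℝ :=
  (1 / 2) * ∑' j, radius α j * digitSign (a j)

lemma summable_norm_radius_mul_digitSign (hα : IsCantorSequence α) (k : ℕ) (a : ℕ → Fin 2) :
    Summable fun j => ‖radius α (j + k) * digitSign (a j)‖ := by
  simpa [abs_mul, abs_digitSign, abs_of_pos (radius_pos hα _)] using summable_radius hα k

lemma abs_tsum_radius_mul_digitSign_le (hα : IsCantorSequence α) (k : ℕ) (a : ℕ → Fin 2) :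
    |∑' j, radius α (j + k) * digitSign (a j)| ≤ ∑' j, radius α (j + k) := by
  have h := norm_tsum_le_tsum_norm (summable_norm_radius_mul_digitSign hα k a)
  simpa [abs_mul, abs_digitSign, abs_of_pos (radius_pos hα _)] using h

lemma codedPoint_eq (hα : IsCantorSequence α) (a : ℕ → Fin 2) (k : ℕ) :
    codedPoint α a = (1 / 2) * ((∑ j ∈ Finset.range k, radius α j * digitSign (a j)) +
      ∑' j, radius α (j + k) * digitSign (a (j + k))) := by
  unfold codedPoint
  rw [Summable.sum_add_tsum_nat_add k]
  exact (summable_norm_radius_mul_digitSign hα 0 a).of_norm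

lemma codedPoint_mem_cantorSet {n : ℕ} (hα : IsCantorSequence α) (a : Fin n → ℕ → Fin 2) {x : E n}
    (hx : ∀ i, x i = codedPoint α (a i)) : x ∈ cantorSet n α := by
  refine mem_iInter₂.2 fun k _ => mem_iUnion₂.2
    ⟨fun j => WithLp.toLp 2 fun i => digitSign (a i j), fun j i => digitSign_eq _, fun i => ?_⟩
  have hc : center (n := n) α (fun j : Fin k => WithLp.toLp 2 fun i => digitSign (a i j)) i =
      1 / 2 * ∑ j ∈ Finset.range k, radius α j * digitSign (a i j) := by
    simp [center, Finset.sum_range]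
  have h1 := abs_le.1 (abs_tsum_radius_mul_digitSign_le hα k fun j => a i (j + k))
  have h2 := tsum_radius_lt hα k
  rw [hc, hx, codedPoint_eq hα (a i) k]
  constructor <;> linarith [h1.1, h1.2]

/-- Two codes that first differ at the place `m` give points in the same interval of generation `m`,
but in different intervals of generation `m + 1`. -/
lemma le_abs_codedPoint_sub (hα : IsCantorSequence α) {a b : ℕ → Fin 2} {m : ℕ}
    (hlt : ∀ j < m, a j = b j) (hm : a m ≠ b m) :
    (2 ^ m)⁻¹ * (α m - α (m + 1)) ≤ |codedPoint α a - codedPoint α b| := by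
  have h1 := abs_le.1 (abs_tsum_radius_mul_digitSign_le hα (m + 1) fun j => a (j + (m + 1)))
  have h2 := abs_le.1 (abs_tsum_radius_mul_digitSign_le hα (m + 1) fun j => b (j + (m + 1)))
  have h3 := tsum_radius_lt hα (m + 1)
  have h4 : 2 * radius α (m + 1) = (2 ^ m)⁻¹ * α (m + 1) := by
    unfold radius
    rw [pow_succ, mul_inv]
    ring
  have hs : ∑ j ∈ Finset.range m, radius α j * digitSign (a j) =
      ∑ j ∈ Finset.range m, radius α j * digitSign (b j) :=
    Finset.sum_congr rfl fun j hj => by rw [hlt j (Finset.mem_range.1 hj)]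
  have hd : (digitSign (a m) = 1 ∧ digitSign (b m) = -1) ∨
      (digitSign (a m) = -1 ∧ digitSign (b m) = 1) := by
    generalize a m = c at hm
    generalize b m = d at hm
    fin_cases c <;> fin_cases d <;> simp_all [digitSign] <;> norm_num
  rw [codedPoint_eq hα a (m + 1), codedPoint_eq hα b (m + 1), Finset.sum_range_succ,
    Finset.sum_range_succ, hs, mul_sub, le_abs]
  change radius α m - _ ≤ _ ∨ radius α m - _ ≤ _
  rcases hd with ⟨ha, hb⟩ | ⟨ha, hb⟩
  · left
    rw [ha, hb]
    linarith [h1.1, h2.2]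
  · right
    rw [ha, hb]
    linarith [h1.2, h2.1]

end Coding

/-! ### The dimension of the Cantor set -/

/-- The map from the Cantor set to the number with the same binary code is Hölder continuous with
every exponent below one: codes that first differ at the place `m` give numbers at distance at most
`2⁻ᵐ` and points at distance at least `2⁻ᵐ / (m + 2)²`. -/
lemma exists_abs_ofDigits_sub_le {r : ℝ} (hr0 : 0 < r) (hr1 : r < 1) :
    ∃ C : ℝ, 0 ≤ C ∧ ∀ a b : ℕ → Fin 2, |Real.ofDigits a - Real.ofDigits b| ≤
      C * |codedPoint harmonicSeq a - codedPoint harmonicSeq b| ^ r := by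
  -- With `ρ = 2 ^ (r - 1) < 1`, the claim amounts to a bound for `(m + 2)² ρᵐ`.
  set ρ : ℝ := (1 / 2 : ℝ) ^ (1 - r) with hρ
  have hρ0 : 0 < ρ := by positivity
  have hρ1 : ρ < 1 := Real.rpow_lt_one (by norm_num) (by norm_num) (by linarith)
  obtain ⟨C, hC⟩ := ((tendsto_pow_const_mul_const_pow_of_abs_lt_one 2
    (abs_lt.2 ⟨by linarith, hρ1⟩)).comp (tendsto_add_atTop_nat 2)).bddAbove_range
  have hC' : ∀ m : ℕ, ((m : ℝ) + 2) ^ 2 * ρ ^ m ≤ C / ρ ^ 2 := by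
    intro m
    have := hC (mem_range_self m)
    simp only [Function.comp_apply] at this
    push_cast at this
    rw [le_div_iff₀ (by positivity)]
    calc _ = ((m : ℝ) + 2) ^ 2 * ρ ^ (m + 2) := by ring
      _ ≤ C := this
  have hC0 : 0 ≤ C / ρ ^ 2 := le_trans (by positivity) (hC' 0)
  refine ⟨C / ρ ^ 2, hC0, fun a b => ?_⟩
  by_cases hab : a = b
  · subst hab
    simpa using mul_nonneg hC0 (by positivity)
  have hex : ∃ m, a m ≠ b m := Function.ne_iff.1 hab
  classical
  have hm := Nat.find_spec hex
  have hlt : ∀ j < Nat.find hex, a j = b j := fun j hj => not_not.1 (Nat.find_min hex hj)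
  set m := Nat.find hex
  have hY := Real.abs_ofDigits_sub_ofDigits_le hlt
  have hX : (1 / 2) ^ m * (1 / ((m : ℝ) + 2) ^ 2) ≤
      |codedPoint harmonicSeq a - codedPoint harmonicSeq b| := by
    refine le_trans ?_ (le_abs_codedPoint_sub isCantorSequence_harmonicSeq hlt hm)
    rw [one_div, inv_pow]
    exact mul_le_mul_of_nonneg_left (harmonicSeq_sub_succ_ge m) (by positivity)
  have hm2 : (0 : ℝ) < (m : ℝ) + 2 := by positivity
  have hm3 : (1 : ℝ) / ((m : ℝ) + 2) ^ 2 ≤ 1 := by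
    rw [div_le_one (by positivity)]
    nlinarith [(Nat.cast_nonneg m : (0 : ℝ) ≤ m)]
  have hp : (1 / 2 : ℝ) ^ m = ρ ^ m * ((1 / 2 : ℝ) ^ m) ^ r := by
    rw [hρ, ← Real.rpow_natCast, ← Real.rpow_natCast, ← Real.rpow_mul (by norm_num),
      ← Real.rpow_mul (by norm_num), ← Real.rpow_add (by norm_num)]
    congr 1
    ring
  calc |Real.ofDigits a - Real.ofDigits b| ≤ (1 / 2 : ℝ) ^ m := by
        simpa [one_div, inv_pow] using hY
    _ = ((m : ℝ) + 2) ^ 2 * ρ ^ m * (((1 / 2 : ℝ) ^ m) ^ r * (1 / ((m : ℝ) + 2) ^ 2)) := by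
        refine hp.trans ?_
        field_simp
    _ ≤ C / ρ ^ 2 * (((1 / 2 : ℝ) ^ m) ^ r * (1 / ((m : ℝ) + 2) ^ 2)) := by
        gcongr
        exact hC' m
    _ ≤ C / ρ ^ 2 * (((1 / 2 : ℝ) ^ m) ^ r * (1 / ((m : ℝ) + 2) ^ 2) ^ r) := by
        gcongr
        exact Real.self_le_rpow_of_le_one (by positivity) hm3 hr1.le
    _ = C / ρ ^ 2 * ((1 / 2 : ℝ) ^ m * (1 / ((m : ℝ) + 2) ^ 2)) ^ r := by
        rw [Real.mul_rpow (by positivity) (by positivity)]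
    _ ≤ _ := by gcongr

lemma norm_le_sum_abs {n : ℕ} (z : E n) : ‖z‖ ≤ ∑ i, |z i| := by
  rw [EuclideanSpace.norm_eq]
  refine Real.sqrt_le_iff.2 ⟨Finset.sum_nonneg fun _ _ => abs_nonneg _, ?_⟩
  exact Finset.sum_sq_le_sq_sum_of_nonneg fun _ _ => abs_nonneg _

lemma natCast_le_dimH_cantorSet_div {n : ℕ} {r : ℝ≥0} (hr0 : 0 < r) (hr1 : r < 1) :
    (n : ℝ≥0∞) ≤ dimH (cantorSet n harmonicSeq) / r := by
  obtain ⟨C, hC0, hC⟩ := exists_abs_ofDigits_sub_le (r := r) hr0 hr1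
  set X := codedPoint harmonicSeq
  -- The Hölder estimate shows that the choice of a code in `invFun` does not matter.
  set g : ℝ → ℝ := fun t => Real.ofDigits (Function.invFun X t)
  have hXX : ∀ a, X (Function.invFun X (X a)) = X a := fun a => Function.invFun_eq ⟨a, rfl⟩
  have hg : ∀ a, g (X a) = Real.ofDigits a := fun a => by
    have := hC (Function.invFun X (X a)) a
    rw [hXX, sub_self, abs_zero, Real.zero_rpow (by exact_mod_cast hr0.ne'), mul_zero] at this
    exact sub_eq_zero.1 (abs_nonpos_iff.1 this)
  set S : Set (E n) := {x | ∀ i, x i ∈ range X}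
  set f : E n → E n := fun x => WithLp.toLp 2 fun i => g (x i)
  have hf : HolderOnWith (n * ⟨C, hC0⟩) r f S := by
    intro x hx y hy
    rw [edist_nndist, edist_nndist, ← ENNReal.coe_rpow_of_nonneg _ r.coe_nonneg, ← ENNReal.coe_mul,
      ENNReal.coe_le_coe, ← NNReal.coe_le_coe]
    push_cast
    rw [dist_eq_norm]
    refine (norm_le_sum_abs _).trans ?_
    calc ∑ i, |(f x - f y) i| ≤ ∑ _i : Fin n, C * dist x y ^ (r : ℝ) := by
          refine Finset.sum_le_sum fun i _ => ?_
          obtain ⟨a, ha⟩ := hx i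
          obtain ⟨b, hb⟩ := hy i
          have hxy : |x i - y i| ≤ dist x y := by
            rw [dist_eq_norm]
            exact PiLp.norm_apply_le (x - y) i
          calc |(f x - f y) i| = |Real.ofDigits a - Real.ofDigits b| := by
                simp [f, ← ha, ← hb, hg]
            _ ≤ C * |X a - X b| ^ (r : ℝ) := hC a b
            _ ≤ C * dist x y ^ (r : ℝ) := by
                rw [ha, hb]
                gcongr
      _ = n * C * dist x y ^ (r : ℝ) := by simp [mul_assoc]
  have hS : S ⊆ cantorSet n harmonicSeq := by
    intro x hx
    choose a ha using hx
    exact codedPoint_mem_cantorSet isCantorSequence_harmonicSeq a fun i => (ha i).symm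
  have hO : IsOpen {y : E n | ∀ i, y i ∈ Ioo (0 : ℝ) 1} := by
    simp only [ofPred_forall]
    exact isOpen_iInter_of_finite fun i =>
      isOpen_Ioo.preimage (EuclideanSpace.proj (𝕜 := ℝ) i).continuous
  have himg : {y : E n | ∀ i, y i ∈ Ioo (0 : ℝ) 1} ⊆ f '' S := by
    intro y hy
    choose a ha using fun i =>
      Real.ofDigits_SurjOn (b := 2) one_lt_two (Ioo_subset_Icc_self (hy i))
    refine ⟨WithLp.toLp 2 fun i => X (a i), fun i => ⟨a i, rfl⟩, ?_⟩
    ext i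
    simp [f, hg, (ha i).2]
  have hnhds : f '' S ∈ 𝓝 (WithLp.toLp 2 fun _ => 1 / 2 : E n) :=
    mem_of_superset (hO.mem_nhds fun i => by norm_num) himg
  calc (n : ℝ≥0∞) = dimH (f '' S) := by simp [Real.dimH_of_mem_nhds hnhds]
    _ ≤ dimH S / r := hf.dimH_image_le hr0
    _ ≤ _ := by gcongr

lemma dimH_le_natCast {n : ℕ} (s : Set (E n)) : dimH s ≤ n :=
  (dimH_mono (subset_univ s)).trans_eq (by simp [Real.dimH_univ_eq_finrank])

lemma dimH_cantorSet (n : ℕ) : dimH (cantorSet n harmonicSeq) = n := by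
  refine le_antisymm (dimH_le_natCast _) (le_of_not_gt fun h => ?_)
  have htop := Real.dimH_ne_top (cantorSet n harmonicSeq)
  have key : ∀ r : ℝ≥0, 0 < r → r < 1 → (n : ℝ≥0) * r ≤
      (dimH (cantorSet n harmonicSeq)).toNNReal := by
    intro r h0 h1
    have := natCast_le_dimH_cantorSet_div (n := n) h0 h1
    rw [ENNReal.le_div_iff_mul_le (by simp [h0.ne']) (by simp)] at this
    rw [← ENNReal.coe_le_coe, ENNReal.coe_toNNReal htop]
    simpa using this
  have hle : (n : ℝ≥0) ≤ (dimH (cantorSet n harmonicSeq)).toNNReal := by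
    have hlim : Tendsto (fun r : ℝ≥0 => (n : ℝ≥0) * r) (𝓝[<] 1) (𝓝 (n * 1)) :=
      (tendsto_id.mono_left nhdsWithin_le_nhds).const_mul _
    have : (𝓝[<] (1 : ℝ≥0)).NeBot := nhdsLT_neBot_of_exists_lt ⟨0, zero_lt_one⟩
    rw [mul_one] at hlim
    refine le_of_tendsto hlim ?_
    filter_upwards [Ioo_mem_nhdsLT (zero_lt_one : (0 : ℝ≥0) < 1)] with r hr
    exact key r hr.1 hr.2
  rw [← ENNReal.coe_toNNReal htop] at h
  exact absurd (by exact_mod_cast h) (not_lt.2 hle)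

lemma nonempty_cantorSet {n : ℕ} {α : ℕ → ℝ} (hα : IsCantorSequence α) :
    (cantorSet n α).Nonempty :=
  ⟨_, codedPoint_mem_cantorSet hα (fun _ _ => 0) (x := WithLp.toLp 2 fun _ => codedPoint α _)
    fun _ => rfl⟩

/-- A set off which `f` is injective contains all points but one of a set on which `f` is
constant. -/
lemma dimH_eq_of_injOn_diff {n : ℕ} {f : E n → E n} {A U N : Set (E n)} (hAU : A ⊆ U)
    (hA : dimH A = n) (hconst : (f '' A).Subsingleton) (hN : InjOn f (U \ N)) : dimH N = n := by
  refine le_antisymm (dimH_le_natCast _) ?_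
  have hsub : (A \ N).Subsingleton := fun x hx y hy =>
    hN ⟨hAU hx.1, hx.2⟩ ⟨hAU hy.1, hy.2⟩
      (hconst (mem_image_of_mem f hx.1) (mem_image_of_mem f hy.1))
  have h := dimH_union (A \ N) (A ∩ N)
  rw [sdiff_union_inter, hA, dimH_subsingleton hsub, max_eq_right zero_le] at h
  rw [h]
  exact dimH_mono inter_subset_right

/-! ### The cube -/

lemma isClosed_closedCube (n : ℕ) : IsClosed (closedCube n) := by
  simp only [closedCube, ofPred_forall]
  exact isClosed_iInter fun i =>
    isClosed_Icc.preimage (EuclideanSpace.proj (𝕜 := ℝ) i).continuous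

lemma isOpen_openCube {n : ℕ} (a : E n) (r : ℝ) : IsOpen (openCube a r) := by
  simp only [openCube, ofPred_forall]
  exact isOpen_iInter_of_finite fun i =>
    isOpen_Ioo.preimage (EuclideanSpace.proj (𝕜 := ℝ) i).continuous

lemma isCompact_closedCube (n : ℕ) : IsCompact (closedCube n) := by
  refine Metric.isCompact_of_isClosed_isBounded (isClosed_closedCube n)
    (isBounded_iff_forall_norm_le.2 ⟨n, fun x hx => (norm_le_sum_abs x).trans ?_⟩)
  calc ∑ i, |x i| ≤ ∑ _i : Fin n, (1 : ℝ) := Finset.sum_le_sum fun i _ => abs_le.2 (hx i)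
    _ = n := by simp

lemma convex_closedCube (n : ℕ) : Convex ℝ (closedCube n) := by
  intro x hx y hy a b ha hb hab i
  exact convex_Icc (-1 : ℝ) 1 (hx i) (hy i) ha hb hab

lemma openCube_zero_one_subset (n : ℕ) : openCube (0 : E n) 1 ⊆ closedCube n := by
  intro x hx i
  have := hx i
  simp only [PiLp.zero_apply, zero_sub, zero_add] at this
  exact Ioo_subset_Icc_self this

/-- A boundary point of the cube lies on a face. -/
lemma exists_apply_eq_of_mem_frontier {n : ℕ} {x : E n} (hx : x ∈ frontier (closedCube n)) :
    ∃ i, x i = 1 ∨ x i = -1 := by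
  by_contra! h
  have hxc : x ∈ closedCube n := (isClosed_closedCube n).frontier_subset hx
  refine hx.2 (mem_interior.2 ⟨_, openCube_zero_one_subset n, isOpen_openCube _ _, fun i => ?_⟩)
  simp only [PiLp.zero_apply, zero_sub, zero_add]
  exact ⟨lt_of_le_of_ne (hxc i).1 (h i).2.symm, lt_of_le_of_ne (hxc i).2 (h i).1⟩

lemma IsCubeHomeomorphism.comp {n : ℕ} {f g : E n → E n} (hf : IsCubeHomeomorphism f)
    (hg : IsCubeHomeomorphism g) : IsCubeHomeomorphism (f ∘ g) := by
  obtain ⟨h, hh⟩ := hf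
  obtain ⟨k, hk⟩ := hg
  exact ⟨k.trans h, fun x => by simp [hh, hk]⟩

lemma isCubeHomeomorphism_of_bijOn {n : ℕ} {f : E n → E n} (hc : Continuous f)
    (hf : BijOn f (closedCube n) (closedCube n)) : IsCubeHomeomorphism f := by
  have : CompactSpace (closedCube n) := isCompact_iff_compactSpace.1 (isCompact_closedCube n)
  exact ⟨Continuous.homeoOfEquivCompactToT2 (f := hf.equiv f)
    ((hc.comp continuous_subtype_val).subtype_mk _), fun x => rfl⟩

/-! ### Squeezing in one coordinate direction -/

/-- Two functions of one variable from which the squeezing maps are built. The function `push`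
is a monotone self-map of `[-1,1]` that fixes the end points and sends `Z` to zero; the function
`cut`, which vanishes at the end points, is less than one except on `Z`. -/
structure SqueezeProfile (Z : Set ℝ) where
  /-- The monotone function that collapses `Z`. -/
  push : ℝ → ℝ
  /-- The function that measures how close a point is to `Z`. -/
  cut : ℝ → ℝ
  contDiff_push : ContDiff ℝ 1 push
  monotone_push : Monotone push
  push_one : push 1 = 1
  push_neg_one : push (-1) = -1
  push_eq_zero : ∀ t ∈ Z, push t = 0
  contDiff_cut : ContDiff ℝ 1 cut
  cut_nonneg : ∀ t, 0 ≤ cut t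
  cut_le_one : ∀ t, cut t ≤ 1
  cut_one : cut 1 = 0
  cut_neg_one : cut (-1) = 0
  cut_eq_one_iff : ∀ t, cut t = 1 ↔ t ∈ Z

lemma nonempty_squeezeProfile {Z : Set ℝ} (hZ : IsClosed Z) (hZ' : ∀ t ∈ Z, |t| ≤ 3 / 4) :
    Nonempty (SqueezeProfile Z) := by
  obtain ⟨v, hsupp, hv, hrange⟩ := hZ.isOpen_compl.exists_contDiff_support_eq (n := 1)
  have hv01 : ∀ t, 0 ≤ v t ∧ v t ≤ 1 := fun t => hrange (mem_range_self t)
  have hv0 : ∀ t, v t = 0 ↔ t ∈ Z := fun t => by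
    rw [← not_iff_not, ← mem_compl_iff, ← hsupp, Function.mem_support]
  set q : ℝ → ℝ := fun t => Real.smoothTransition (4 * t - 3) - Real.smoothTransition (-4 * t - 3)
    with hq
  have hqdiff : ContDiff ℝ 1 q :=
    (Real.smoothTransition.contDiff.comp (by fun_prop)).sub
      (Real.smoothTransition.contDiff.comp (by fun_prop))
  have hqZ : ∀ t ∈ Z, q t = 0 := fun t ht => by
    have := abs_le.1 (hZ' t ht)
    simp only [hq]
    rw [Real.smoothTransition.zero_of_nonpos (by linarith),
      Real.smoothTransition.zero_of_nonpos (by linarith), sub_zero]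
  have hq1 : q 1 = 1 := by
    simp only [hq]
    rw [Real.smoothTransition.one_of_one_le (by norm_num),
      Real.smoothTransition.zero_of_nonpos (by norm_num), sub_zero]
  have hqn1 : q (-1) = -1 := by
    simp only [hq]
    rw [Real.smoothTransition.zero_of_nonpos (by norm_num),
      Real.smoothTransition.one_of_one_le (by norm_num), zero_sub]
  have hqsq : ∀ t, q t ^ 2 ≤ 1 := fun t => by
    rw [sq_le_one_iff_abs_le_one, abs_le]
    have h1 := Real.smoothTransition.nonneg (4 * t - 3)
    have h2 := Real.smoothTransition.le_one (4 * t - 3)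
    have h3 := Real.smoothTransition.nonneg (-4 * t - 3)
    have h4 := Real.smoothTransition.le_one (-4 * t - 3)
    constructor <;> simp only [hq] <;> linarith
  exact ⟨{
    push := q
    cut := fun t => (1 - v t) * (1 - q t ^ 2)
    contDiff_push := hqdiff
    monotone_push := fun s t hst => sub_le_sub
      (Real.smoothTransition.monotone (by linarith)) (Real.smoothTransition.monotone (by linarith))
    push_one := hq1
    push_neg_one := hqn1
    push_eq_zero := hqZ
    contDiff_cut := (contDiff_const.sub hv).mul (contDiff_const.sub (hqdiff.pow 2))
    cut_nonneg := fun t => mul_nonneg (by linarith [(hv01 t).2]) (by linarith [hqsq t])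
    cut_le_one := fun t => mul_le_one₀ (by linarith [(hv01 t).1]) (by linarith [hqsq t])
      (by linarith [sq_nonneg (q t)])
    cut_one := by simp [hq1]
    cut_neg_one := by simp [hqn1]
    cut_eq_one_iff := fun t => by
      rw [← hv0]
      constructor
      · intro h
        nlinarith [hv01 t, hqsq t, sq_nonneg (q t)]
      · intro h
        simp [h, hqZ t ((hv0 t).1 h)] }⟩

namespace SqueezeProfile

variable {n : ℕ} {Z : Set ℝ} (P : SqueezeProfile Z)

/-- The amount by which the line through `x` in direction `i` is squeezed. It equals one if and
only if all the other coordinates of `x` are in `Z`. -/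
noncomputable def weight (i : Fin n) (x : E n) : ℝ := ∏ j ∈ Finset.univ.erase i, P.cut (x j)

/-- The map that moves the point `x` in direction `i`, from the coordinate `t = x i` towards
`P.push t`, by the fraction `s * P.weight i x` of the distance. -/
noncomputable def squeeze (s : ℝ) (i : Fin n) (x : E n) : E n :=
  x + (s * P.weight i x * (P.push (x i) - x i)) • EuclideanSpace.single i 1

lemma weight_nonneg (i : Fin n) (x : E n) : 0 ≤ P.weight i x :=
  Finset.prod_nonneg fun _ _ => P.cut_nonneg _

lemma weight_le_cut {i j : Fin n} (hij : j ≠ i) (x : E n) : P.weight i x ≤ P.cut (x j) := by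
  unfold weight
  rw [← Finset.mul_prod_erase _ _ (Finset.mem_erase.2 ⟨hij, Finset.mem_univ j⟩)]
  exact mul_le_of_le_one_right (P.cut_nonneg _)
    (Finset.prod_le_one (fun _ _ => P.cut_nonneg _) fun _ _ => P.cut_le_one _)

lemma weight_le_one (i : Fin n) (x : E n) : P.weight i x ≤ 1 :=
  Finset.prod_le_one (fun _ _ => P.cut_nonneg _) fun _ _ => P.cut_le_one _

lemma weight_congr {i : Fin n} {x y : E n} (h : ∀ j ≠ i, x j = y j) :
    P.weight i x = P.weight i y :=
  Finset.prod_congr rfl fun j hj => by rw [h j (Finset.ne_of_mem_erase hj)]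

lemma weight_eq_one {i : Fin n} {x : E n} (h : ∀ j ≠ i, x j ∈ Z) : P.weight i x = 1 :=
  Finset.prod_eq_one fun j hj => (P.cut_eq_one_iff _).2 (h j (Finset.ne_of_mem_erase hj))

lemma contDiff_weight (i : Fin n) : ContDiff ℝ 1 (P.weight i) := by
  unfold weight
  exact contDiff_prod fun j _ =>
    P.contDiff_cut.comp (EuclideanSpace.proj (𝕜 := ℝ) j).contDiff

lemma squeeze_apply_same (s : ℝ) (i : Fin n) (x : E n) :
    P.squeeze s i x i = (1 - s * P.weight i x) * x i + s * P.weight i x * P.push (x i) := by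
  simp [squeeze]
  ring

lemma squeeze_apply_of_ne (s : ℝ) {i j : Fin n} (hij : j ≠ i) (x : E n) :
    P.squeeze s i x j = x j := by
  simp [squeeze, hij]

lemma contDiff_push_sub (i : Fin n) : ContDiff ℝ 1 fun x : E n => P.push (x i) - x i :=
  (P.contDiff_push.comp (EuclideanSpace.proj (𝕜 := ℝ) i).contDiff).sub
    (EuclideanSpace.proj (𝕜 := ℝ) i).contDiff

lemma contDiff_squeeze (i : Fin n) :
    ContDiff ℝ 1 fun p : ℝ × E n => P.squeeze p.1 i p.2 := by
  unfold squeeze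
  exact contDiff_snd.add (((contDiff_fst.mul ((P.contDiff_weight i).comp contDiff_snd)).mul
    ((P.contDiff_push_sub i).comp contDiff_snd)).smul contDiff_const)

lemma contDiff_squeeze_right (s : ℝ) (i : Fin n) : ContDiff ℝ 1 (P.squeeze s i) :=
  (P.contDiff_squeeze i).comp (contDiff_prodMk_right s)

lemma squeeze_eq_self_of_mem_frontier (s : ℝ) (i : Fin n) {x : E n}
    (hx : x ∈ frontier (closedCube n)) : P.squeeze s i x = x := by
  obtain ⟨j, hj⟩ := exists_apply_eq_of_mem_frontier hx
  by_cases hij : j = i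
  · subst hij
    rcases hj with hj | hj <;> simp [squeeze, hj, P.push_one, P.push_neg_one]
  · have hw : P.weight i x = 0 := by
      refine le_antisymm ((P.weight_le_cut hij x).trans_eq ?_) (P.weight_nonneg i x)
      rcases hj with hj | hj <;> simp [hj, P.cut_one, P.cut_neg_one]
    simp [squeeze, hw]

lemma push_mem_Icc {t : ℝ} (ht : t ∈ Icc (-1 : ℝ) 1) : P.push t ∈ Icc (-1 : ℝ) 1 :=
  ⟨P.push_neg_one ▸ P.monotone_push ht.1, P.push_one ▸ P.monotone_push ht.2⟩

lemma mapsTo_squeeze {s : ℝ} (hs : s ∈ Icc (0 : ℝ) 1) (i : Fin n) :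
    MapsTo (P.squeeze s i) (closedCube n) (closedCube n) := by
  intro x hx j
  by_cases hij : j = i
  · subst hij
    rw [squeeze_apply_same]
    have h0 : 0 ≤ s * P.weight j x := mul_nonneg hs.1 (P.weight_nonneg j x)
    have h1 : s * P.weight j x ≤ 1 := mul_le_one₀ hs.2 (P.weight_nonneg j x) (P.weight_le_one j x)
    exact convex_Icc (-1 : ℝ) 1 (hx j) (P.push_mem_Icc (hx j)) (by linarith) h0 (by ring)
  · rw [P.squeeze_apply_of_ne s hij]
    exact hx j

lemma strictMono_convexComb {c : ℝ} (hc0 : 0 ≤ c) (hc1 : c < 1) :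
    StrictMono fun t => (1 - c) * t + c * P.push t := by
  intro t u htu
  have h1 : (1 - c) * t < (1 - c) * u := mul_lt_mul_of_pos_left htu (by linarith)
  have h2 := mul_le_mul_of_nonneg_left (P.monotone_push htu.le) hc0
  exact add_lt_add_of_lt_of_le h1 h2

lemma injOn_squeeze {s : ℝ} (hs : 0 ≤ s) (i : Fin n) :
    InjOn (P.squeeze s i) {x | s * P.weight i x < 1} := by
  intro x hx y _ hxy
  have hne : ∀ j ≠ i, x j = y j := fun j hj => by
    rw [← P.squeeze_apply_of_ne s hj x, hxy, P.squeeze_apply_of_ne s hj]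
  have hi : P.squeeze s i x i = P.squeeze s i y i := by rw [hxy]
  rw [squeeze_apply_same, squeeze_apply_same, ← P.weight_congr hne] at hi
  have hi' := (P.strictMono_convexComb (mul_nonneg hs (P.weight_nonneg i x)) hx).injective hi
  ext j
  by_cases hj : j = i
  · rw [hj, hi']
  · exact hne j hj

lemma surjOn_squeeze (s : ℝ) (i : Fin n) :
    SurjOn (P.squeeze s i) (closedCube n) (closedCube n) := by
  intro y hy
  set c := s * P.weight i y with hc
  have hcont : ContinuousOn (fun t => (1 - c) * t + c * P.push t) (Icc (-1) 1) := by
    have := P.contDiff_push.continuous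
    fun_prop
  obtain ⟨t, ht, hty⟩ := intermediate_value_Icc (by norm_num) hcont
    (show y i ∈ Icc ((1 - c) * (-1) + c * P.push (-1)) ((1 - c) * 1 + c * P.push 1) by
      rw [P.push_one, P.push_neg_one]
      exact ⟨by linarith [(hy i).1], by linarith [(hy i).2]⟩)
  set x : E n := y + (t - y i) • EuclideanSpace.single i 1
  have hxi : x i = t := by simp [x]
  have hxne : ∀ j ≠ i, x j = y j := fun j hj => by simp [x, hj]
  refine ⟨x, fun j => ?_, ?_⟩
  · by_cases hj : j = i
    · rw [hj, hxi]
      exact ht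
    · rw [hxne j hj]
      exact hy j
  · ext j
    by_cases hj : j = i
    · rw [hj, squeeze_apply_same, P.weight_congr hxne, hxi, ← hc]
      exact hty
    · rw [P.squeeze_apply_of_ne s hj, hxne j hj]

lemma isCubeHomeomorphism_squeeze {s : ℝ} (hs : s ∈ Ico (0 : ℝ) 1) (i : Fin n) :
    IsCubeHomeomorphism (P.squeeze s i) := by
  refine isCubeHomeomorphism_of_bijOn (P.contDiff_squeeze_right s i).continuous
    ⟨P.mapsTo_squeeze (Ico_subset_Icc_self hs) i,
      (P.injOn_squeeze hs.1 i).mono fun x _ => ?_, P.surjOn_squeeze s i⟩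
  exact (mul_le_of_le_one_right hs.1 (P.weight_le_one i x)).trans_lt hs.2

/-- The derivative is a rank one perturbation of the identity, so the Jacobian is the partial
derivative of the `i`-th component in direction `i`, which is `1 - w + w * deriv P.push (x i)` with
`w = P.weight i x`. -/
lemma one_sub_weight_le_det_fderiv_squeeze (i : Fin n) (x : E n) :
    1 - P.weight i x ≤ (fderiv ℝ (P.squeeze 1 i) x).det := by
  set g : E n → ℝ := fun x => 1 * P.weight i x * (P.push (x i) - x i)
  set e : E n := EuclideanSpace.single i 1 with he
  have hg : HasFDerivAt g (fderiv ℝ g x) x :=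
    (((contDiff_const.mul (P.contDiff_weight i)).mul (P.contDiff_push_sub i)).differentiable
      one_ne_zero x).hasFDerivAt
  have hdet : (fderiv ℝ (P.squeeze 1 i) x).det = 1 + fderiv ℝ g x e := by
    have h := (hasFDerivAt_id x).add (hg.smul_const e)
    change HasFDerivAt (P.squeeze 1 i) _ x at h
    rw [h.fderiv]
    exact LinearMap.transvection.det (fderiv ℝ g x : E n →ₗ[ℝ] ℝ) e
  have hline : HasDerivAt (fun t : ℝ => P.weight i x * (P.push (x i + t) - (x i + t)))
      (fderiv ℝ g x e) 0 := by
    have h : HasDerivAt (fun t : ℝ => g (x + t • e)) (fderiv ℝ g x e) 0 := hg.hasLineDerivAt e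
    refine h.congr_of_eventuallyEq (Eventually.of_forall fun t => ?_)
    have hw : P.weight i (x + t • e) = P.weight i x :=
      P.weight_congr fun j hj => by simp [he, hj]
    simp only [g, hw]
    simp [he]
  have hpush := (P.contDiff_push.differentiable one_ne_zero (x i)).hasDerivAt
  have hline' := ((((by simpa using hpush : HasDerivAt P.push (deriv P.push (x i))
    (x i + 0)).comp_const_add (x i) 0).sub ((hasDerivAt_id (0 : ℝ)).const_add (x i))).const_mul
      (P.weight i x))
  rw [hdet, hline.unique hline']
  nlinarith [mul_nonneg (P.weight_nonneg i x) (P.monotone_push.deriv_nonneg (x := x i))]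

end SqueezeProfile

/-! ### Null sets and the Jacobian -/

/-- By the change of variables formula, an injective `C¹` map with nonvanishing Jacobian pulls null
sets back to null sets. -/
lemma volume_inter_preimage_eq_zero {n : ℕ} {f : E n → E n} (hf : ContDiff ℝ 1 f) {s N : Set (E n)}
    (hs : MeasurableSet s) (hinj : InjOn f s) (hdet : ∀ x ∈ s, (fderiv ℝ f x).det ≠ 0)
    (hN : volume N = 0) : volume (s ∩ f ⁻¹' N) = 0 := by
  -- The set `N` need not be measurable.
  set t := s ∩ f ⁻¹' toMeasurable volume N
  have ht : MeasurableSet t :=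
    hs.inter (hf.continuous.measurable (measurableSet_toMeasurable volume N))
  have himg : volume (f '' t) = 0 :=
    measure_mono_null (image_subset_iff.2 inter_subset_right) ((measure_toMeasurable N).trans hN)
  rw [← lintegral_abs_det_fderiv_eq_addHaar_image volume ht
    (fun x _ => (hf.differentiable one_ne_zero x).hasFDerivAt.hasFDerivWithinAt)
    (hinj.mono inter_subset_left)] at himg
  have hmeas : Measurable fun x => ENNReal.ofReal |(fderiv ℝ f x).det| :=
    ENNReal.measurable_ofReal.comp (continuous_abs.measurable.comp
      (ContinuousLinearMap.continuous_det.comp (hf.continuous_fderiv one_ne_zero)).measurable)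
  have hae := (setLIntegral_eq_zero_iff ht hmeas).1 himg
  refine measure_mono_null (fun x hx => ?_) hae
  have hxt : x ∈ t := ⟨hx.1, subset_toMeasurable volume N hx.2⟩
  simpa using ⟨hxt, hdet x hx.1⟩

namespace SqueezeProfile

variable {n : ℕ} {Z : Set ℝ} (P : SqueezeProfile Z)

lemma ae_weight_lt_one (hn : 2 ≤ n) (hZ : volume Z = 0) (i : Fin n) :
    ∀ᵐ x : E n, P.weight i x < 1 := by
  have : Nontrivial (Fin n) := Fin.nontrivial_iff_two_le.2 hn
  obtain ⟨j, hj⟩ := exists_ne i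
  refine measure_mono_null (fun x hx => ?_) (volume_setOf_apply_mem j hZ)
  exact (P.cut_eq_one_iff _).1
    (le_antisymm (P.cut_le_one _) ((not_lt.1 (show ¬ P.weight i x < 1 from hx)).trans
      (P.weight_le_cut hj x)))

/-- Pulling back under `P.squeeze 1 i` preserves properties that hold almost everywhere: the map is
injective with positive Jacobian where the weight is less than one, which is almost everywhere. -/
lemma ae_squeeze_one (hn : 2 ≤ n) (hZ : volume Z = 0) (i : Fin n) {p : E n → Prop}
    (hp : ∀ᵐ x ∂volume.restrict (closedCube n), p x) :
    ∀ᵐ x ∂volume.restrict (closedCube n), p (P.squeeze 1 i x) := by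
  rw [ae_restrict_iff' (isClosed_closedCube n).measurableSet] at hp ⊢
  have hnull := volume_inter_preimage_eq_zero (P.contDiff_squeeze_right 1 i)
    (s := {x | 1 * P.weight i x < 1})
    (measurableSet_lt ((P.contDiff_weight i).continuous.measurable.const_mul 1) measurable_const)
    (P.injOn_squeeze zero_le_one i)
    (fun x hx => by
      have h1 := P.one_sub_weight_le_det_fderiv_squeeze i x
      have h2 : 1 * P.weight i x < 1 := hx
      exact (by linarith : 0 < (fderiv ℝ (P.squeeze 1 i) x).det).ne') hp
  filter_upwards [measure_eq_zero_iff_ae_notMem.1 hnull, P.ae_weight_lt_one hn hZ i]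
    with x hx hw hxc
  by_contra hpx
  refine hx ⟨by simpa using hw, fun h => hpx (h (P.mapsTo_squeeze ⟨zero_le_one, le_rfl⟩ i hxc))⟩

/-! ### Squeezing in all coordinate directions -/

/-- The composition of the maps `P.squeeze s i`, with `i` running through the list. -/
noncomputable def squeezeList (s : ℝ) : List (Fin n) → E n → E n
  | [] => id
  | i :: l => squeezeList s l ∘ P.squeeze s i

lemma contDiff_squeezeList (l : List (Fin n)) :
    ContDiff ℝ 1 fun p : ℝ × E n => P.squeezeList p.1 l p.2 := by
  induction l with
  | nil => exact contDiff_snd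
  | cons i l ih => exact ih.comp (contDiff_fst.prodMk (P.contDiff_squeeze i))

lemma contDiff_squeezeList_right (s : ℝ) (l : List (Fin n)) :
    ContDiff ℝ 1 (P.squeezeList s l) :=
  (P.contDiff_squeezeList l).comp (contDiff_prodMk_right s)

lemma squeezeList_eq_self_of_mem_frontier (s : ℝ) (l : List (Fin n)) {x : E n}
    (hx : x ∈ frontier (closedCube n)) : P.squeezeList s l x = x := by
  induction l with
  | nil => rfl
  | cons i l ih =>
    rw [squeezeList, Function.comp_apply, P.squeeze_eq_self_of_mem_frontier s i hx, ih]

lemma mapsTo_squeezeList {s : ℝ} (hs : s ∈ Icc (0 : ℝ) 1) (l : List (Fin n)) :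
    MapsTo (P.squeezeList s l) (closedCube n) (closedCube n) := by
  induction l with
  | nil => exact mapsTo_id _
  | cons i l ih => exact ih.comp (P.mapsTo_squeeze hs i)

lemma isCubeHomeomorphism_squeezeList {s : ℝ} (hs : s ∈ Ico (0 : ℝ) 1) (l : List (Fin n)) :
    IsCubeHomeomorphism (P.squeezeList s l) := by
  induction l with
  | nil => exact ⟨Homeomorph.refl _, fun _ => rfl⟩
  | cons i l ih => exact ih.comp (P.isCubeHomeomorphism_squeeze hs i)

lemma ae_det_fderiv_squeezeList_pos (hn : 2 ≤ n) (hZ : volume Z = 0) (l : List (Fin n)) :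
    ∀ᵐ x ∂volume.restrict (closedCube n), 0 < (fderiv ℝ (P.squeezeList 1 l) x).det := by
  induction l with
  | nil =>
    refine Eventually.of_forall fun x => ?_
    rw [squeezeList, fderiv_id]
    exact one_pos.trans_eq LinearMap.det_id.symm
  | cons i l ih =>
    filter_upwards [P.ae_squeeze_one hn hZ i ih, ae_restrict_of_ae (P.ae_weight_lt_one hn hZ i)]
      with x hx hw
    rw [squeezeList, fderiv_comp _
      ((P.contDiff_squeezeList_right 1 l).differentiable one_ne_zero _)
      ((P.contDiff_squeeze_right 1 i).differentiable one_ne_zero _), ContinuousLinearMap.det,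
      ContinuousLinearMap.toLinearMap_comp, LinearMap.det_comp]
    exact mul_pos hx (by linarith [P.one_sub_weight_le_det_fderiv_squeeze i x] :
      0 < (fderiv ℝ (P.squeeze 1 i) x).det)

/-- Each of the squeezing maps moves one more coordinate of the points of `Zⁿ` to zero. As
`0 ∈ Z`, the next map still squeezes its lines through these points completely. -/
lemma squeezeList_one_eq_zero (h0 : (0 : ℝ) ∈ Z) (l : List (Fin n)) {x : E n}
    (hx : ∀ j, x j ∈ Z) (hl : ∀ j ∉ l, x j = 0) : P.squeezeList 1 l x = 0 := by
  induction l generalizing x with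
  | nil =>
    ext j
    exact hl j List.not_mem_nil
  | cons i l ih =>
    have hi : P.squeeze 1 i x i = 0 := by
      rw [squeeze_apply_same, P.weight_eq_one fun j _ => hx j, P.push_eq_zero _ (hx i)]
      ring
    refine ih (fun j => ?_) fun j hj => ?_
    · by_cases hij : j = i
      · rwa [hij, hi]
      · rw [P.squeeze_apply_of_ne 1 hij]
        exact hx j
    · by_cases hij : j = i
      · rw [hij, hi]
      · rw [P.squeeze_apply_of_ne 1 hij]
        exact hl j (by simp [hij, hj])

end SqueezeProfile

/-! ### Sobolev convergence of `C¹` families -/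

lemma hasWeakDeriv_fderiv {n : ℕ} {U : Set (E n)} {f : E n → E n}
    (hf : ContDiff ℝ 1 f) : HasWeakDeriv U f (fderiv ℝ f) where
  locallyIntegrable := hf.continuous.locallyIntegrable.locallyIntegrableOn U
  locallyIntegrable_deriv :=
    (hf.continuous_fderiv one_ne_zero).locallyIntegrable.locallyIntegrableOn U
  integral_eq φ hφ hφc hφU w := by
    have hf' := hf.continuous_fderiv one_ne_zero
    have hφ' : Continuous (fderiv ℝ φ) := hφ.continuous_fderiv (by simp)
    have h0 : ∀ x ∉ U, φ x = 0 := fun x hx => image_eq_zero_of_notMem_tsupport fun h => hx (hφU h)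
    have h0' : ∀ x ∉ U, fderiv ℝ φ x = 0 := fun x hx =>
      image_eq_zero_of_notMem_tsupport fun h => hx (hφU (tsupport_fderiv_subset ℝ h))
    rw [setIntegral_eq_integral_of_forall_compl_eq_zero fun x hx => by simp [h0' x hx],
      setIntegral_eq_integral_of_forall_compl_eq_zero fun x hx => by simp [h0 x hx],
      integral_smul_fderiv_eq_neg_fderiv_smul_of_integrable, neg_neg]
    · exact ((hφ'.clm_apply continuous_const).smul hf.continuous).integrable_of_hasCompactSupport
        (HasCompactSupport.smul_right (hφc.fderiv_apply ℝ w))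
    · exact (hφ.continuous.smul (hf'.clm_apply continuous_const)).integrable_of_hasCompactSupport
        hφc.smul_right
    · exact (hφ.continuous.smul hf.continuous).integrable_of_hasCompactSupport hφc.smul_right
    · exact fun x _ => hφ.differentiable (by simp) x
    · exact fun x _ => hf.differentiable one_ne_zero x

section Family

variable {n : ℕ} {U K : Set (E n)} {p : ℝ≥0∞} {F : Type*} [NormedAddCommGroup F]

lemma memLp_restrict_of_subset_isCompact [SecondCountableTopology F] (hK : IsCompact K)
    (hUK : U ⊆ K) {f : E n → F} (hf : Continuous f) : MemLp f p (volume.restrict U) := by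
  obtain ⟨C, hC⟩ := hK.exists_bound_of_continuousOn hf.continuousOn
  have : IsFiniteMeasure (volume.restrict K) := isFiniteMeasure_restrict.2 hK.measure_ne_top
  exact (MemLp.of_bound hf.aestronglyMeasurable C
    ((ae_restrict_iff' hK.measurableSet).2 (Eventually.of_forall hC))).mono_measure
      (Measure.restrict_mono hUK le_rfl)

lemma tendsto_eLpNorm_sub_of_continuous (hK : IsCompact K) (hUK : U ⊆ K)
    {H : ℝ → E n → F} (hH : Continuous (Function.uncurry H)) {s : ℕ → ℝ} {a : ℝ}
    (hs : Tendsto s atTop (𝓝 a)) :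
    Tendsto (fun k => eLpNorm (H (s k) - H a) p (volume.restrict U)) atTop (𝓝 0) := by
  have hunif : TendstoUniformlyOn H (H a) (𝓝 a) K := by
    have huc : UniformContinuousOn (Function.uncurry H) (Icc (a - 1) (a + 1) ×ˢ K) :=
      (isCompact_Icc.prod hK).uniformContinuousOn_of_continuous hH.continuousOn
    have h := UniformContinuousOn.tendstoUniformlyOn huc
      (⟨by linarith, by linarith⟩ : a ∈ Icc (a - 1) (a + 1))
    rwa [nhdsWithin_eq_nhds.2 (Icc_mem_nhds (by linarith) (by linarith))] at h
  set M : ℝ≥0∞ := volume.restrict K univ ^ p.toReal⁻¹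
  have hM : M ≠ ⊤ := by
    refine ENNReal.rpow_ne_top_of_nonneg (inv_nonneg.2 ENNReal.toReal_nonneg) ?_
    rw [Measure.restrict_apply_univ]
    exact hK.measure_ne_top
  have hM0 : Tendsto (fun ε : ℝ => M * ENNReal.ofReal ε) (𝓝[>] 0) (𝓝 0) := by
    have h := ENNReal.Tendsto.const_mul (a := M)
      (ENNReal.tendsto_ofReal (tendsto_id (x := 𝓝 (0 : ℝ)))) (Or.inr hM)
    rw [ENNReal.ofReal_zero, mul_zero] at h
    exact h.mono_left nhdsWithin_le_nhds
  rw [ENNReal.tendsto_nhds_zero]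
  intro δ hδ
  obtain ⟨ε, hεδ, hε⟩ := ((ENNReal.tendsto_nhds_zero.1 hM0 δ hδ).and self_mem_nhdsWithin).exists
  filter_upwards [hs.eventually (Metric.tendstoUniformlyOn_iff.1 hunif ε hε)] with k hk
  calc eLpNorm (H (s k) - H a) p (volume.restrict U)
      ≤ eLpNorm (H (s k) - H a) p (volume.restrict K) :=
        eLpNorm_mono_measure _ (Measure.restrict_mono hUK le_rfl)
    _ ≤ M * ENNReal.ofReal ε := by
        refine eLpNorm_le_of_ae_bound ((ae_restrict_iff' hK.measurableSet).2
          (Eventually.of_forall fun x hx => ?_))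
        rw [Pi.sub_apply, ← dist_eq_norm, dist_comm]
        exact (hk x hx).le
    _ ≤ δ := hεδ

/-- A family of maps that is `C¹` jointly in the parameter and the point depends continuously, in
every Sobolev norm over a bounded set, on the parameter. -/
lemma tendstoSobolev_of_contDiff (hK : IsCompact K) (hUK : U ⊆ K)
    {H : ℝ → E n → E n} (hH : ContDiff ℝ 1 (Function.uncurry H)) {s : ℕ → ℝ} {a : ℝ}
    (hs : Tendsto s atTop (𝓝 a)) : TendstoSobolev U p (fun k => H (s k)) (H a) := by
  have hHr : ∀ t, ContDiff ℝ 1 (H t) := fun t => hH.comp (contDiff_prodMk_right t)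
  have hmem : ∀ t, MemSobolev U p (H t) := fun t =>
    ⟨memLp_restrict_of_subset_isCompact hK hUK (hHr t).continuous, fderiv ℝ (H t),
      hasWeakDeriv_fderiv (hHr t), memLp_restrict_of_subset_isCompact hK hUK
        ((hHr t).continuous_fderiv one_ne_zero)⟩
  have hH' : Continuous (Function.uncurry fun t => fderiv ℝ (H t)) := by
    have : ContDiff ℝ 1 (Function.uncurry fun q : ℝ × E n => H q.1) :=
      hH.comp ((contDiff_fst.comp contDiff_fst).prodMk contDiff_snd)
    exact (ContDiff.fderiv (n := 0) this contDiff_snd (by simp)).continuous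
  exact ⟨fun k => hmem _, hmem a, tendsto_eLpNorm_sub_of_continuous hK hUK hH.continuous hs,
    fun k => fderiv ℝ (H (s k)), fderiv ℝ (H a), fun k => hasWeakDeriv_fderiv (hHr _),
    hasWeakDeriv_fderiv (hHr a), tendsto_eLpNorm_sub_of_continuous hK hUK hH' hs⟩

end Family

lemma cantorSet_subset_openCube (n : ℕ) : cantorSet n harmonicSeq ⊆ openCube (0 : E n) 1 := by
  intro x hx i
  have := abs_le.1 (abs_le_of_mem_cantorLine (apply_mem_cantorLine hx i))
  simp only [PiLp.zero_apply, zero_sub, zero_add]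
  exact ⟨by linarith, by linarith⟩

end CantorSqueeze

theorem mainTheorem8 (n : ℕ) (hn : 2 ≤ n) :
    ∃ (α : ℕ → ℝ) (fL : CantorSqueeze.E n → CantorSqueeze.E n)
      (f : ℕ → CantorSqueeze.E n → CantorSqueeze.E n),
      -- the Cantor set `C_A` has Hausdorff dimension `n` and measure zero
      CantorSqueeze.IsCantorSequence α ∧
      dimH (CantorSqueeze.cantorSet n α) = n ∧
      volume (CantorSqueeze.cantorSet n α) = 0 ∧
      -- `fL : [-1,1]ⁿ → [-1,1]ⁿ` is Lipschitz with positive Jacobian a.e.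
      MapsTo fL (CantorSqueeze.closedCube n) (CantorSqueeze.closedCube n) ∧
      (∃ K : ℝ≥0, LipschitzOnWith K fL (CantorSqueeze.closedCube n)) ∧
      (∀ᵐ x ∂(volume.restrict (CantorSqueeze.closedCube n)),
        DifferentiableAt ℝ fL x ∧ 0 < (fderiv ℝ fL x).det) ∧
      -- `fL` is the strong limit in `W^{1,n-1}` of homeomorphisms fixing the boundary
      (∀ k, CantorSqueeze.IsCubeHomeomorphism (f k)) ∧
      (∀ k, ∀ x ∈ frontier (CantorSqueeze.closedCube n), f k x = x) ∧
      CantorSqueeze.TendstoSobolev (CantorSqueeze.openCube (0 : CantorSqueeze.E n) 1)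
        ((n - 1 : ℕ) : ℝ≥0∞) f fL ∧
      -- `fL` maps `C_A` to a single point
      (∃ y, fL '' CantorSqueeze.cantorSet n α = {y}) ∧
      -- hence every set off which `fL` is one-to-one has full Hausdorff dimension
      (∀ N : Set (CantorSqueeze.E n),
        InjOn fL (CantorSqueeze.openCube (0 : CantorSqueeze.E n) 1 \ N) → dimH N = n) := by
  open CantorSqueeze in
  set Z : Set ℝ := cantorLine harmonicSeq ∪ {0}
  have hZ : IsClosed Z := (isClosed_cantorLine _).union isClosed_singleton
  have hZ0 : volume Z = 0 :=
    measure_union_null (volume_cantorLine tendsto_harmonicSeq) (measure_singleton 0)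
  have hZle : ∀ t ∈ Z, |t| ≤ 3 / 4 := by
    rintro t (ht | rfl)
    · exact abs_le_of_mem_cantorLine ht
    · norm_num
  obtain ⟨P⟩ := nonempty_squeezeProfile hZ hZle
  set l := List.finRange n
  have himage : P.squeezeList 1 l '' cantorSet n harmonicSeq = {0} := by
    refine ((nonempty_cantorSet isCantorSequence_harmonicSeq).image _).subset_singleton_iff.1 ?_
    rintro _ ⟨x, hx, rfl⟩
    exact P.squeezeList_one_eq_zero (Or.inr rfl) l (fun j => Or.inl (apply_mem_cantorLine hx j))
      fun j hj => absurd (List.mem_finRange j) hj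
  have hs : ∀ k : ℕ, 1 - harmonicSeq k ∈ Ico (0 : ℝ) 1 := fun k => by
    have h1 := isCantorSequence_harmonicSeq.pos k
    have h2 := isCantorSequence_harmonicSeq.strictAnti.antitone (Nat.zero_le k)
    rw [isCantorSequence_harmonicSeq.zero] at h2
    exact ⟨by linarith, by linarith⟩
  have hlim : Tendsto (fun k => 1 - harmonicSeq k) atTop (𝓝 1) := by
    simpa using tendsto_harmonicSeq.const_sub 1
  refine ⟨harmonicSeq, P.squeezeList 1 l, fun k => P.squeezeList (1 - harmonicSeq k) l,
    isCantorSequence_harmonicSeq, dimH_cantorSet n,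
    volume_cantorSet (by omega) tendsto_harmonicSeq,
    P.mapsTo_squeezeList ⟨zero_le_one, le_rfl⟩ l,
    (P.contDiff_squeezeList_right 1 l).contDiffOn.exists_lipschitzOnWith one_ne_zero
      (convex_closedCube n) (isCompact_closedCube n), ?_,
    fun k => P.isCubeHomeomorphism_squeezeList (hs k) l,
    fun k x hx => P.squeezeList_eq_self_of_mem_frontier _ l hx,
    tendstoSobolev_of_contDiff (isCompact_closedCube n) (openCube_zero_one_subset n)
      (H := fun t => P.squeezeList t l) (P.contDiff_squeezeList l) hlim,
    ⟨0, himage⟩, fun N hN => ?_⟩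
  · filter_upwards [P.ae_det_fderiv_squeezeList_pos hn hZ0 l] with x hx
    exact ⟨(P.contDiff_squeezeList_right 1 l).differentiable one_ne_zero x, hx⟩
  · exact dimH_eq_of_injOn_diff (cantorSet_subset_openCube n) (dimH_cantorSet n)
      (himage ▸ subsingleton_singleton) hN
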